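/- Theorem (discriminant criterion, eighth powers). Let $\mathcal{O}$ be an order in an algebraic number field $K$, that is, a subring of $K$ with unity which is finitely generated as a $\mathbb{Z}$-module and has $\mathbb{Z}$-rank $[K:\mathbb{Q}]$, and let $\operatorname{disc}\mathcal{O}$ be its discriminant, i.e. $\det(\operatorname{Tr}_{K/\mathbb{Q}}(b_i b_j))$ for any $\mathbb{Z}$-basis $(b_i)$ of $\mathcal{O}$. Let $n \ge 2$ be an integer. Then every matrix in $M_n(\mathcal{O})$ is a sum of (finitely many) eighth powers of matrices in $M_n(\mathcal{O})$ if and only if $\gcd(2, \operatorname{disc}\mathcal{O}) = 1$. -/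

import Mathlib

/-- An order of a number field `K`: a subring with unity (a `Subring` contains `1`) that is
finitely generated as a `ℤ`-module, of rank equal to the degree of `K` over `ℚ`. -/
class IsNumberFieldOrder {K : Type*} [Field K] [NumberField K] (O : Subring K) : Prop where
  finite : Module.Finite ℤ O
  rank_eq : Module.finrank ℤ O = Module.finrank ℚ K

instance IsNumberFieldOrder.moduleFinite {K : Type*} [Field K] [NumberField K] (O : Subring K)
    [h : IsNumberFieldOrder O] : Module.Finite ℤ O := h.finite

instance IsNumberFieldOrder.moduleFree {K : Type*} [Field K] [NumberField K] (O : Subring K)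
    [IsNumberFieldOrder O] : Module.Free ℤ O :=
  inferInstance

/-- The discriminant of an order `O`: the determinant of the matrix of traces `Tr (bᵢ bⱼ)` for a
`ℤ`-basis `b` of `O`. It does not depend on the basis, see `orderDiscr_eq`. -/
noncomputable def orderDiscr {K : Type*} [Field K] [NumberField K] (O : Subring K)
    [IsNumberFieldOrder O] : ℤ :=
  Algebra.discr ℤ (Module.finBasis ℤ O)

theorem orderDiscr_eq {K : Type*} [Field K] [NumberField K] (O : Subring K)
    [IsNumberFieldOrder O] {ι : Type*} [Fintype ι] [DecidableEq ι] (b : Module.Basis ι ℤ O) :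
    orderDiscr O = Algebra.discr ℤ b := by
  let b₀ := (Module.finBasis ℤ O).reindex ((Module.finBasis ℤ O).indexEquiv b)
  rw [Algebra.discr_eq_discr O b b₀, Module.Basis.coe_reindex, Algebra.discr_reindex]
  rfl

/-- `M` is a sum of `k`-th powers of matrices over `R`. -/
def IsSumOfMatrixPowers {R : Type*} [CommRing R] {n : ℕ} (k : ℕ)
    (M : Matrix (Fin n) (Fin n) R) : Prop :=
  ∃ (r : ℕ) (A : Fin r → Matrix (Fin n) (Fin n) R), M = ∑ i, A i ^ k

/-! Both sides say that squaring is surjective on `O/2O`. An odd discriminant means that `𝔽₂ ⊗ O`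
has nondegenerate trace form, i.e. is reduced, i.e. has injective Frobenius; finiteness makes this
surjectivity. Necessity: modulo 2, `tr (B²) = (tr B)²`, so a sum of even powers has trace a square
mod 2, while traces of matrices are arbitrary. Sufficiency: every trace-zero 2×2 matrix is a sum of
eighth powers, so only traces matter, and those of eighth powers generate the ring additively.
Larger matrices reduce to 2×2 blocks. -/

theorem AddSubmonoid.eq_top_of_eighth_power_traces {R : Type*} [CommRing R] (T : AddSubmonoid R)
    (hT : ∀ t d : R, t ^ 8 - 8 * t ^ 6 * d + 20 * t ^ 4 * d ^ 2 - 16 * t ^ 2 * d ^ 3 + 2 * d ^ 4 ∈ T)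
    (hsq : ∀ x : R, ∃ y z, x = y ^ 2 + 2 * z) : T = ⊤ := by
  have hpow (x : R) : x ^ 8 ∈ T := by simpa using hT x 0
  have hnpow (x : R) : -x ^ 8 ∈ T := by
    convert hT x (x ^ 2) using 1
    ring
  -- The seventh difference of `x ^ 8` is `8! * x + 141120`.
  have h40320 (x : R) : 40320 * x ∈ T := by
    have h1 : (141120 : ℕ) • (-1 : R) ∈ T := T.nsmul_mem (by simpa using hnpow 1) _
    have h (m : ℕ) (y : R) : m • y ^ 8 ∈ T := T.nsmul_mem (hpow y) _
    have h' (m : ℕ) (y : R) : m • -y ^ 8 ∈ T := T.nsmul_mem (hnpow y) _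
    convert add_mem (add_mem (add_mem (add_mem (add_mem (add_mem (add_mem (add_mem
      (h 1 (x + 7)) (h' 7 (x + 6))) (h 21 (x + 5))) (h' 35 (x + 4))) (h 35 (x + 3)))
      (h' 21 (x + 2))) (h 7 (x + 1))) (h' 1 x)) h1 using 1
    simp only [nsmul_eq_mul]
    push_cast
    ring
  -- `T` is in fact a group, since it contains `40320 * R`.
  have hneg (x : R) (hx : x ∈ T) : -x ∈ T := by
    convert add_mem (T.nsmul_mem hx 40319) (h40320 (-x)) using 1
    simp only [nsmul_eq_mul]
    push_cast
    ring
  have hsub {x y : R} (hx : x ∈ T) (hy : y ∈ T) : x - y ∈ T := by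
    rw [sub_eq_add_neg]
    exact add_mem hx (hneg y hy)
  have hone : (1 : R) ∈ T := by simpa using hpow 1
  have hquart (d : R) : 2 * d ^ 4 ∈ T := by simpa using hT 0 d
  have hcub (d : R) : -8 * d + 20 * d ^ 2 - 16 * d ^ 3 ∈ T := by
    convert hsub (hsub (hT 1 d) hone) (hquart d) using 1
    ring
  have h40 (d : R) : 40 * d ^ 2 ∈ T := by
    convert add_mem (hcub d) (hcub (-d)) using 1
    ring
  have h80 (d : R) : 80 * d ∈ T := by
    convert hsub (hsub (h40 (d + 1)) (h40 d)) (h40 1) using 1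
    ring
  have h96 (d : R) : 96 * d ∈ T := by
    convert hsub (hsub (add_mem (hcub (d + 1)) (hcub (d + 1))) (add_mem (hcub (d + 2)) (hcub d)))
      (T.nsmul_mem hone 56) using 1
    simp only [nsmul_eq_mul]
    push_cast
    ring
  have h16 (d : R) : 16 * d ∈ T := by
    convert hsub (h96 d) (h80 d) using 1
    ring
  have h8 (d : R) : 8 * d ∈ T := by
    convert hsub (hsub (hsub (hcub d) (hcub (d + 1))) (T.nsmul_mem hone 4)) (h16 (3 * d ^ 2))
      using 1
    simp only [nsmul_eq_mul]
    push_cast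
    ring
  -- From here squares mod 2 lift: `hcub y` is `4 * y ^ 2` mod 8, `2 * w ^ 4` handles mod 4, and `s
  -- ^ 8` mod 2.
  have h4 (x : R) : 4 * x ∈ T := by
    obtain ⟨y, z, rfl⟩ := hsq x
    convert add_mem (hcub y) (h8 (z + y - 2 * y ^ 2 + 2 * y ^ 3)) using 1
    ring
  have h2 (x : R) : 2 * x ∈ T := by
    obtain ⟨y, z, rfl⟩ := hsq x
    obtain ⟨w, v, rfl⟩ := hsq y
    convert add_mem (hquart w) (h4 (z + 2 * w ^ 2 * v + 2 * v ^ 2)) using 1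
    ring
  refine eq_top_iff.2 fun x _ => ?_
  obtain ⟨y, z, rfl⟩ := hsq x
  obtain ⟨w, v, rfl⟩ := hsq y
  obtain ⟨s, r, rfl⟩ := hsq w
  convert add_mem (hpow s) (h2 (z + 2 * (s ^ 2 + 2 * r) ^ 2 * v + 2 * v ^ 2 + 4 * s ^ 6 * r +
    12 * s ^ 4 * r ^ 2 + 16 * s ^ 2 * r ^ 3 + 8 * r ^ 4)) using 1
  ring

/-! ### Sums of eighth powers of matrices -/

namespace Matrix

variable {R : Type*} [CommRing R]

/-- The sums of `k`-th powers of matrices, as an additive submonoid. -/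
def powerSums (m R : Type*) [Fintype m] [DecidableEq m] [CommRing R] (k : ℕ) :
    AddSubmonoid (Matrix m m R) :=
  AddSubmonoid.closure (Set.range fun A => A ^ k)

theorem pow_mem_powerSums {m : Type*} [Fintype m] [DecidableEq m] (A : Matrix m m R) (k : ℕ) :
    A ^ k ∈ powerSums m R k :=
  AddSubmonoid.subset_closure ⟨A, rfl⟩

theorem isSumOfMatrixPowers_of_mem_powerSums {n k : ℕ} {M : Matrix (Fin n) (Fin n) R}
    (hM : M ∈ powerSums (Fin n) R k) : IsSumOfMatrixPowers k M := by
  induction hM using AddSubmonoid.closure_induction with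
  | mem _ h =>
    obtain ⟨A, rfl⟩ := h
    exact ⟨1, fun _ => A, by simp⟩
  | zero => exact ⟨0, Fin.elim0, by simp⟩
  | add _ _ _ _ h₁ h₂ =>
    obtain ⟨r, A, rfl⟩ := h₁
    obtain ⟨s, B, rfl⟩ := h₂
    exact ⟨r + s, Fin.append A B, by simp [Fin.sum_univ_add]⟩

theorem mem_powerSums_of_isIdempotentElem {m : Type*} [Fintype m] [DecidableEq m]
    {E : Matrix m m R} (hE : IsIdempotentElem E) (k : ℕ) : E ∈ powerSums m R (k + 1) := by
  rw [← hE.pow_succ_eq k]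
  exact pow_mem_powerSums E _

theorem isIdempotentElem_fin_two {a b c d : R} (hdet : a * d = b * c) (htr : a + d = 1) :
    IsIdempotentElem !![a, b; c, d] := by
  rw [IsIdempotentElem, mul_fin_two]
  obtain rfl : d = 1 - a := by linear_combination htr
  congr! 2
  · exact congrArg₂ (![·, ·]) (by linear_combination -hdet) (by ring)
  · exact congrArg (![·]) (congrArg₂ (![·, ·]) (by ring) (by linear_combination -hdet))

/-- The two matrices are `A` and `A²` with `A² + A + 1 = 0`; as `A³ = 1`, eighth powers swap them.
-/
theorem neg_one_mem_powerSums_eight : (-1 : Matrix (Fin 2) (Fin 2) R) ∈ powerSums (Fin 2) R 8 := by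
  convert add_mem (pow_mem_powerSums !![(0 : R), -1; 1, -1] 8)
    (pow_mem_powerSums !![(-1 : R), 1; -1, 0] 8) using 1
  ext i j
  fin_cases i <;> fin_cases j <;> simp [pow_succ]

/-- Idempotents are their own eighth powers; two of trace 1 together with `-1` have trace zero. -/
theorem of_trace_zero_mem_powerSums_eight (a b c : R) :
    !![a, b; c, -a] ∈ powerSums (Fin 2) R 8 := by
  have hup (x : R) : !![0, x; 0, 0] ∈ powerSums (Fin 2) R 8 := by
    convert add_mem (add_mem
      (mem_powerSums_of_isIdempotentElem (E := !![(1 : R), x; 0, 0]) (isIdempotentElem_fin_two (by simp) (by simp)) 7)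
      (mem_powerSums_of_isIdempotentElem (E := !![(0 : R), 0; 0, 1]) (isIdempotentElem_fin_two (by simp) (by simp)) 7))
      neg_one_mem_powerSums_eight using 1
    ext i j
    fin_cases i <;> fin_cases j <;> simp
  have hlow (x : R) : !![0, 0; x, 0] ∈ powerSums (Fin 2) R 8 := by
    convert add_mem (add_mem
      (mem_powerSums_of_isIdempotentElem (E := !![(1 : R), 0; x, 0]) (isIdempotentElem_fin_two (by simp) (by simp)) 7)
      (mem_powerSums_of_isIdempotentElem (E := !![(0 : R), 0; 0, 1]) (isIdempotentElem_fin_two (by simp) (by simp)) 7))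
      neg_one_mem_powerSums_eight using 1
    ext i j
    fin_cases i <;> fin_cases j <;> simp
  have hE : IsIdempotentElem !![1 + a, 1; -(a * (1 + a)), -a] :=
    isIdempotentElem_fin_two (by ring) (by ring)
  convert add_mem (add_mem (add_mem (add_mem (mem_powerSums_of_isIdempotentElem hE 7)
    (mem_powerSums_of_isIdempotentElem (E := !![(0 : R), 0; 0, 1]) (isIdempotentElem_fin_two (by simp) (by simp)) 7))
    neg_one_mem_powerSums_eight) (hup (b - 1))) (hlow (c + a * (1 + a))) using 1
  ext i j
  fin_cases i <;> fin_cases j <;> simp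

theorem powerSums_fin_two_eight_eq_top (hsq : ∀ x : R, ∃ y z, x = y ^ 2 + 2 * z) :
    powerSums (Fin 2) R 8 = ⊤ := by
  -- Trace-zero matrices move the trace into the corner; the companion matrix of `X² - tX + d`
  -- yields the required polynomial.
  let T := (powerSums (Fin 2) R 8).comap (singleAddMonoidHom (0 : Fin 2) (0 : Fin 2))
  have hT : T = ⊤ := by
    refine T.eq_top_of_eighth_power_traces (fun t d => ?_) hsq
    have hA : !![t, -d; 1, 0] ^ 8 = ((!![t, -d; 1, 0] ^ 2) ^ 2) ^ 2 := by
      rw [← pow_mul, ← pow_mul]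
    have h := pow_mem_powerSums !![t, -d; 1, 0] 8
    set B := !![t, -d; 1, 0] ^ 8 with hB
    rw [AddSubmonoid.mem_comap]
    convert add_mem h (of_trace_zero_mem_powerSums_eight (B 1 1) (-B 0 1) (-B 1 0)) using 1
    have htr : t ^ 8 - 8 * t ^ 6 * d + 20 * t ^ 4 * d ^ 2 - 16 * t ^ 2 * d ^ 3 + 2 * d ^ 4 =
        B 0 0 + B 1 1 := by
      rw [hA]
      simp only [pow_two, mul_fin_two, of_apply, cons_val', cons_val_zero, cons_val_one,
        cons_val_fin_one]
      ring
    ext i j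
    fin_cases i <;> fin_cases j <;> simp [singleAddMonoidHom, htr]
  refine eq_top_iff.2 fun M _ => ?_
  have h : M 0 0 + M 1 1 ∈ T := hT ▸ AddSubmonoid.mem_top _
  convert add_mem (AddSubmonoid.mem_comap.1 h)
    (of_trace_zero_mem_powerSums_eight (-M 1 1) (M 0 1) (M 1 0)) using 1
  ext i j
  fin_cases i <;> fin_cases j <;> simp [singleAddMonoidHom]

/-- As `Q * P = 1`, the map `A ↦ P * A * Q` is multiplicative, so it preserves positive powers. -/
theorem single_mem_powerSums {m p : Type*} [Fintype m] [DecidableEq m] [Fintype p] [DecidableEq p]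
    {k : ℕ} (h : powerSums p R (k + 1) = ⊤) (f : p ↪ m) (a b : p) (x : R) :
    single (f a) (f b) x ∈ powerSums m R (k + 1) := by
  let P : Matrix m p R := (1 : Matrix m m R).submatrix id f
  let Q : Matrix p m R := (1 : Matrix m m R).submatrix f id
  have hQP : Q * P = 1 := by
    rw [← submatrix_mul _ _ f id f Function.bijective_id, one_mul, submatrix_one_embedding]
  have hpow (A : Matrix p p R) (l : ℕ) : (P * A * Q) ^ (l + 1) = P * A ^ (l + 1) * Q := by
    induction l with
    | zero => simp
    | succ l ih =>
      rw [pow_succ, ih, pow_succ A (l + 1)]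
      calc P * A ^ (l + 1) * Q * (P * A * Q) = P * A ^ (l + 1) * (Q * P) * A * Q := by
            simp only [Matrix.mul_assoc]
        _ = _ := by rw [hQP, Matrix.mul_one, Matrix.mul_assoc P]
  have hmem (A : Matrix p p R) (hA : A ∈ powerSums p R (k + 1)) :
      P * A * Q ∈ powerSums m R (k + 1) := by
    induction hA using AddSubmonoid.closure_induction with
    | mem _ h =>
      obtain ⟨A, rfl⟩ := h
      exact hpow A k ▸ pow_mem_powerSums _ _
    | zero => simp
    | add _ _ _ _ h₁ h₂ =>
      rw [Matrix.mul_add, Matrix.add_mul]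
      exact add_mem h₁ h₂
  convert hmem (single a b x) (h ▸ AddSubmonoid.mem_top _) using 1
  ext i j
  rw [mul_apply, Finset.sum_eq_single b (fun c _ hc => by simp [mul_apply, hc.symm])
    (by simp), mul_apply, Finset.sum_eq_single a
    (fun c _ hc => by simp [hc.symm]) (by simp)]
  simp only [single_apply, P, Q, submatrix_apply, one_apply, id, eq_comm (a := i)]
  by_cases h₁ : f a = i <;> by_cases h₂ : f b = j <;> simp [h₁, h₂]

theorem powerSums_eight_eq_top {n : ℕ} (hn : 2 ≤ n) (hsq : ∀ x : R, ∃ y z, x = y ^ 2 + 2 * z) :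
    powerSums (Fin n) R 8 = ⊤ := by
  have h₂ := powerSums_fin_two_eight_eq_top hsq
  have hoff (i j : Fin n) (hij : i ≠ j) (a b : Fin 2) (x : R) :
      single (![i, j] a) (![i, j] b) x ∈ powerSums (Fin n) R 8 :=
    single_mem_powerSums (k := 7) h₂ ⟨![i, j], by
      intro a b; fin_cases a <;> fin_cases b <;> simp [hij, hij.symm]⟩ a b x
  have : Nontrivial (Fin n) := Fin.nontrivial_iff_two_le.2 hn
  refine eq_top_iff.2 fun M _ => ?_
  rw [matrix_eq_sum_single M]
  refine sum_mem fun i _ => sum_mem fun j _ => ?_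
  rcases eq_or_ne i j with rfl | hij
  · obtain ⟨j, hj⟩ := exists_ne i
    exact hoff i j hj.symm 0 0 _
  · exact hoff i j hij 0 1 _

end Matrix

open scoped TensorProduct

/-! ### Traces of even powers modulo 2 -/

theorem Matrix.trace_sq_of_two_eq_zero {Q m : Type*} [CommRing Q] [Fintype m] (h2 : (2 : Q) = 0)
    (B : Matrix m m Q) : (B * B).trace = B.trace ^ 2 := by
  classical
  have : CharP Q 2 ∨ Subsingleton Q := by
    rcases subsingleton_or_nontrivial Q with h | h
    · exact .inr h
    · exact .inl (CharTwo.of_one_ne_zero_of_two_eq_zero one_ne_zero h2)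
  rcases this with _ | _
  · have hdiag : ∑ x ∈ (Finset.univ : Finset (m × m)) with x.1 ≠ x.2, B x.1 x.2 * B x.2 x.1 = 0 := by
      refine Finset.sum_involution (fun x _ => x.swap) ?_ ?_ ?_ ?_
      · intro x _
        rw [Prod.fst_swap, Prod.snd_swap, mul_comm (B x.2 x.1), CharTwo.add_self_eq_zero]
      · intro x hx _ h
        exact (Finset.mem_filter.1 hx).2 (congrArg Prod.snd h)
      · intro x hx
        simpa [eq_comm] using hx
      · simp
    have hsum : (B * B).trace = ∑ x : m × m, B x.1 x.2 * B x.2 x.1 := by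
      simp [Matrix.trace, Matrix.mul_apply, Fintype.sum_prod_type]
    rw [hsum, ← Finset.sum_filter_add_sum_filter_not Finset.univ (fun x : m × m => x.1 ≠ x.2),
      hdiag, zero_add, Matrix.trace, CharTwo.sum_sq]
    refine Finset.sum_bij' (fun x _ => x.1) (fun i _ => (i, i)) ?_ ?_ ?_ ?_ ?_ <;>
      simp +contextual [sq]
  · exact Subsingleton.elim _ _

theorem exists_eq_sq_add_two_mul_of_isSumOfMatrixPowers {R : Type*} [CommRing R] {n k : ℕ}
    (hn : n ≠ 0) (h : ∀ M : Matrix (Fin n) (Fin n) R, IsSumOfMatrixPowers (2 * k) M) (x : R) :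
    ∃ y z, x = y ^ 2 + 2 * z := by
  have : NeZero n := ⟨hn⟩
  obtain ⟨r, A, hA⟩ := h (Matrix.single 0 0 x)
  let φ := Ideal.Quotient.mk (Ideal.span {(2 : R)})
  have h2 : (2 : R ⧸ Ideal.span {(2 : R)}) = 0 :=
    Ideal.Quotient.eq_zero_iff_mem.2 (Ideal.mem_span_singleton_self 2)
  have htr (B : Matrix (Fin n) (Fin n) R) : φ (B ^ (2 * k)).trace = φ (B ^ k).trace ^ 2 := by
    have := Matrix.trace_sq_of_two_eq_zero h2 (φ.mapMatrix (B ^ k))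
    rwa [← map_mul, ← pow_add, ← two_mul, RingHom.mapMatrix_apply, RingHom.mapMatrix_apply,
      ← AddMonoidHom.map_trace, ← AddMonoidHom.map_trace] at this
  have hx : φ x = φ ((∑ i, (A i ^ k).trace) ^ 2) := by
    have hx' := congrArg Matrix.trace hA
    rw [Matrix.trace_single_eq_same, Matrix.trace_sum] at hx'
    rw [hx', map_sum, map_pow, map_sum]
    simp_rw [htr]
    rcases subsingleton_or_nontrivial (R ⧸ Ideal.span {(2 : R)}) with _ | _
    · exact Subsingleton.elim _ _
    · have := CharTwo.of_one_ne_zero_of_two_eq_zero one_ne_zero h2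
      rw [CharTwo.sum_sq]
  obtain ⟨z, hz⟩ := Ideal.mem_span_singleton.1 (Ideal.Quotient.eq.1 hx)
  exact ⟨_, z, by rw [← hz, add_sub_cancel]⟩

/-! ### Discriminants and reducedness -/

namespace Algebra

variable {k A : Type*} [Field k] [CommRing A] [Algebra k A]

theorem isReduced_of_traceForm_nondegenerate (h : (traceForm k A).Nondegenerate) :
    IsReduced A := by
  refine ⟨fun x hx => h.1 x fun y => ?_⟩
  exact (isNilpotent_trace_of_isNilpotent ((Commute.all x y).isNilpotent_mul_right hx)).eq_zero

/-- If `x` avoids a maximal ideal `m`, then `A` splits off the field `A ⧸ m`, separable over `k`,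
and some multiple of `x` supported there has trace 1. -/
theorem eq_zero_of_trace_mul_eq_zero [FiniteDimensional k A] [PerfectField k] [IsReduced A] {x : A}
    (hx : ∀ y, trace k A (x * y) = 0) : x = 0 := by
  have : IsArtinianRing A := IsArtinianRing.of_finite k A
  have := IsArtinianRing.isSemisimpleRing_of_isReduced A
  have hjac : ∀ m : Ideal A, m.IsMaximal → x ∈ m := by
    intro m hm
    by_contra hxm
    obtain ⟨J, hJ⟩ := exists_isCompl m
    have hcop : IsCoprime m J := Ideal.isCoprime_iff_sup_eq.2 hJ.sup_eq_top
    let e : A ≃ₐ[k] (A ⧸ m) × (A ⧸ J) := AlgEquiv.ofBijective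
      ((Ideal.Quotient.mkₐ k m).prod (Ideal.Quotient.mkₐ k J)) <| by
        constructor
        · refine (injective_iff_map_eq_zero _).2 fun a ha => ?_
          have : a ∈ m ⊓ J := ⟨Ideal.Quotient.eq_zero_iff_mem.1 (congrArg Prod.fst ha),
            Ideal.Quotient.eq_zero_iff_mem.1 (congrArg Prod.snd ha)⟩
          rwa [hJ.inf_eq_bot] at this
        · intro y
          obtain ⟨a, ha⟩ := (Ideal.quotientInfEquivQuotientProd m J hcop).surjective y
          obtain ⟨a, rfl⟩ := Ideal.Quotient.mk_surjective a
          exact ⟨a, ha⟩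
    let _ : Field (A ⧸ m) := Ideal.Quotient.field m
    obtain ⟨w, hw⟩ := Algebra.trace_surjective k (A ⧸ m) 1
    have hx0 : (Ideal.Quotient.mk m x) ≠ 0 := fun h => hxm (Ideal.Quotient.eq_zero_iff_mem.1 h)
    have h := hx (e.symm ((Ideal.Quotient.mk m x)⁻¹ * w, 0))
    rw [← Algebra.trace_eq_of_algEquiv e, map_mul, AlgEquiv.apply_symm_apply] at h
    have hex : e x = (Ideal.Quotient.mk m x, Ideal.Quotient.mk J x) := rfl
    rw [hex, Prod.mk_mul_mk, trace_prod_apply, mul_inv_cancel_left₀ hx0, hw, mul_zero, map_zero,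
      add_zero] at h
    exact one_ne_zero h
  refine (IsArtinianRing.equivPi A).injective ?_
  rw [map_zero]
  exact funext fun m => Ideal.Quotient.eq_zero_iff_mem.2 (hjac m.asIdeal m.isMaximal)

theorem traceForm_nondegenerate_iff_isReduced [FiniteDimensional k A] [PerfectField k] :
    (traceForm k A).Nondegenerate ↔ IsReduced A := by
  refine ⟨isReduced_of_traceForm_nondegenerate, fun _ => ?_⟩
  refine ⟨fun x hx => eq_zero_of_trace_mul_eq_zero (k := k) hx,
    fun x hx => eq_zero_of_trace_mul_eq_zero (k := k) fun y => ?_⟩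
  rw [mul_comm]
  exact hx y

theorem discr_ne_zero_iff_isReduced [FiniteDimensional k A] [PerfectField k] {ι : Type*} [Fintype ι] [DecidableEq ι]
    (b : Module.Basis ι k A) : discr k b ≠ 0 ↔ IsReduced A := by
  rw [← traceForm_nondegenerate_iff_isReduced (k := k), discr_def, traceMatrix_of_basis,
    LinearMap.BilinForm.nondegenerate_iff_det_ne_zero b]

theorem discr_baseChange {R S B ι : Type*} [CommRing R] [CommRing S] [CommRing B] [Algebra R S]
    [Algebra R B] [Fintype ι] [DecidableEq ι] (b : Module.Basis ι R B) :
    discr S (Algebra.TensorProduct.basis S b) = algebraMap R S (discr R b) := by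
  have := Module.Free.of_basis b
  have := Module.Finite.of_basis b
  rw [discr_def, discr_def, RingHom.map_det]
  congr 1
  ext i j
  have hlmul (x : B) : lmul S (S ⊗[R] B) (1 ⊗ₜ x) = (lmul R B x).baseChange S := by
    ext
    simp
  simp only [traceMatrix_apply, traceForm_apply, RingHom.mapMatrix_apply, Matrix.map_apply,
    TensorProduct.basis_apply, TensorProduct.tmul_mul_tmul, mul_one]
  rw [trace_apply, trace_apply, hlmul, LinearMap.trace_baseChange]

end Algebra

/-! ### Reduction of the order modulo 2 -/

theorem one_tmul_zmod_two_eq_zero_iff {B : Type*} [CommRing B] [Module.Finite ℤ B]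
    [Module.Free ℤ B] {x : B} : (1 : ZMod 2) ⊗ₜ[ℤ] x = 0 ↔ ∃ z, x = 2 * z := by
  let b := Module.finBasis ℤ B
  constructor
  · intro h
    have hdvd (i) : ∃ c, b.repr x i = 2 * c := by
      have hi := congrArg (fun t => (Algebra.TensorProduct.basis (ZMod 2) b).repr t i) h
      rw [Algebra.TensorProduct.basis_repr_tmul] at hi
      exact (ZMod.intCast_zmod_eq_zero_iff_dvd _ 2).1 (by simpa using hi)
    choose c hc using hdvd
    refine ⟨b.equivFun.symm c, b.ext_elem fun i => ?_⟩
    rw [hc, two_mul (b.equivFun.symm c), map_add, Finsupp.add_apply, ← b.equivFun_apply, LinearEquiv.apply_symm_apply,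
      two_mul]
  · rintro ⟨z, rfl⟩
    rw [two_mul, TensorProduct.tmul_add, ← TensorProduct.add_tmul, CharTwo.add_self_eq_zero,
      TensorProduct.zero_tmul]

theorem isReduced_zmod_two_tensor_iff {B : Type*} [CommRing B] [Module.Finite ℤ B]
    [Module.Free ℤ B] :
    IsReduced (ZMod 2 ⊗[ℤ] B) ↔ ∀ x : B, ∃ y z, x = y ^ 2 + 2 * z := by
  let φ : B →ₐ[ℤ] ZMod 2 ⊗[ℤ] B := Algebra.TensorProduct.includeRight
  have hφ : Function.Surjective φ := Algebra.TensorProduct.includeRight_surjective _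
    (ZMod.ringHom_surjective _)
  have h0 (x : B) : φ x = 0 ↔ ∃ z, x = 2 * z := one_tmul_zmod_two_eq_zero_iff
  have h2 : (2 : ZMod 2 ⊗[ℤ] B) = 0 := by
    rw [← map_ofNat φ 2]
    exact (h0 2).2 ⟨1, by rw [mul_one]⟩
  have : Finite (ZMod 2 ⊗[ℤ] B) := Module.finite_of_finite (ZMod 2)
  have hsq : (∀ x : B, ∃ y z, x = y ^ 2 + 2 * z) ↔
      Function.Surjective fun t : ZMod 2 ⊗[ℤ] B => t ^ 2 := by
    have hx (x y : B) : φ y ^ 2 = φ x ↔ ∃ z, x = y ^ 2 + 2 * z := by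
      rw [eq_comm, ← map_pow, ← sub_eq_zero, ← map_sub, h0]
      simp_rw [sub_eq_iff_eq_add']
    simp only [Function.Surjective, hφ.forall, hφ.exists, hx]
  rw [hsq, ← Finite.injective_iff_surjective]
  constructor
  · intro _ s t hst
    refine sub_eq_zero.1 (eq_zero_of_pow_eq_zero (n := 2) ?_)
    linear_combination hst + (t ^ 2 - s * t) * h2
  · intro hinj
    refine (isReduced_iff_pow_one_lt 2 one_lt_two).2 fun x hx => hinj ?_
    simpa using hx

theorem gcd_two_orderDiscr_eq_one_iff {K : Type*} [Field K] [NumberField K] (O : Subring K)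
    [IsNumberFieldOrder O] :
    Int.gcd 2 (orderDiscr O) = 1 ↔ ∀ x : O, ∃ y z, x = y ^ 2 + 2 * z := by
  rw [← isReduced_zmod_two_tensor_iff,
    ← Algebra.discr_ne_zero_iff_isReduced (k := ZMod 2)
      (Algebra.TensorProduct.basis (ZMod 2) (Module.finBasis ℤ O)),
    Algebra.discr_baseChange, orderDiscr]
  rw [eq_intCast, Ne, ZMod.intCast_zmod_eq_zero_iff_dvd, Nat.cast_ofNat]
  exact Int.isCoprime_iff_gcd_eq_one.symm.trans Int.prime_two.coprime_iff_not_dvd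

theorem mainTheorem5 {K : Type*} [Field K] [NumberField K] (O : Subring K)
    [IsNumberFieldOrder O] (n : ℕ) (hn : 2 ≤ n) :
    (∀ M : Matrix (Fin n) (Fin n) O, IsSumOfMatrixPowers 8 M) ↔
      Int.gcd 2 (orderDiscr O) = 1 := by
  rw [gcd_two_orderDiscr_eq_one_iff]
  exact ⟨exists_eq_sq_add_two_mul_of_isSumOfMatrixPowers (k := 4) (by lia), fun h M =>
    Matrix.isSumOfMatrixPowers_of_mem_powerSums
      (Matrix.powerSums_eight_eq_top hn h ▸ AddSubmonoid.mem_top M)⟩
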